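/- Let $\epsilon>0$, let $d,m\ge 0$ be integers, and let $v_1,\dots,v_m$ be independent random vectors in $\mathbb{C}^d$ with finite support, that is, each $v_i$ almost surely takes values in some finite set. Suppose that $$\sum_{i=1}^m \mathbb{E}\left[v_i v_i^*\right]=I_d\qquad\text{and}\qquad \mathbb{E}\,\|v_i\|^2\le\epsilon\ \text{ for every } i=1,\dots,m,$$ where $\|v_i\|$ is the Euclidean norm and $v_iv_i^*$ is the $d\times d$ outer product matrix. Then $$\mathbb{P}\left[\ \left\|\sum_{i=1}^m v_i v_i^*\right\|\le\left(1+\sqrt{\epsilon}\right)^2\ \right]>0,$$ where the norm of a matrix is its operator norm with respect to the Euclidean norm on $\mathbb{C}^d$. -/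

import Mathlib

open MeasureTheory ProbabilityTheory

-- The norm of a matrix is its Euclidean operator norm (largest singular value).
open scoped Matrix.Norms.L2Operator

/-- The outer product `v v^*` of a vector `v ∈ ℂ^d`, the `d × d` matrix with entries
`v j * conj (v k)`. -/
def outerProduct {d : ℕ} (v : EuclideanSpace ℂ (Fin d)) : Matrix (Fin d) (Fin d) ℂ :=
  Matrix.of fun j k => v j * starRingEnd ℂ (v k)

/-!
The proof is the method of interlacing polynomials together with the barrier argument, carried out
for polynomial functions `p` on complex `n × n` matrices rather than for polynomials in auxiliary
variables. With `D_A` the derivative in the direction `A`, the polynomial that plays the role of the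
mixed characteristic polynomial of `A₁, …, Aₘ` is `(1 - D_{A₁}) ⋯ (1 - D_{Aₘ}) det`. When every
`Aᵢ = wᵢ wᵢ*` has rank one, the determinant is affine in each direction `Aᵢ`, and this is
`M ↦ det (M - ∑ wᵢ wᵢ*)` (`MatPoly.ev_foldr_subDir_detPoly`).

*Stability.* Call `p` stable if it is real on Hermitian matrices and has no zero `X + iY` with `X`
Hermitian and `Y` positive definite. The determinant is stable, and `1 - D_A` preserves stability
for `A` positive semidefinite: a univariate polynomial `f` without roots in the closed upper half
plane satisfies `Im (f' / f) < 0` there unless it is constant (`logDeriv_im_neg`), so `f' ≠ f`.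

*Shape of the barrier.* Say that `M` lies above the roots of `p` if `p (M + Y) > 0` for all positive
semidefinite `Y`; there the barrier `D_A p / p` is defined. Along a line `t ↦ M + tB` with `B`
positive semidefinite, it is a quotient `N / Q` of real polynomials mapping the upper half plane
into the closed lower one, and `Q` has only real roots. Hence `N / Q` has simple real poles with
nonnegative residues (`PickPair.exists_partialFraction`), so that above the roots it is
nonincreasing and convex (`PickPair.antitoneOn_div`, `PickPair.tangent_le`).

*Barrier argument.* If the barrier in direction `C` is at most `1 - 1/δ` at `M`, then `M + δC` is
above the roots of `(1 - D_C) p`, and no barrier has increased (`MatPoly.IsStable.above_subDir`).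
Start with `det` at `tI`, where `t = √ε + ε`: the barrier in direction `Aᵢ` is
`tr Aᵢ / t ≤ ε / t = 1 - 1/(1 + √ε)`. After all the steps with `δ = 1 + √ε`, as `∑ Aᵢ = I`, the
matrix `(t + δ) I = (1 + √ε)² I` is above the roots of `(1 - D_{A₁}) ⋯ (1 - D_{Aₘ}) det`.

*Selection.* Let `A = ∑ wₛ Bₛ` be a convex combination and let `M` be above the roots of
`(1 - D_A) p`. Then `M` is above the roots of `p` (`MatPoly.IsStable.above_of_above_subDir`), and the barrier
in direction `A`, which is less than `1`, is the average of those in the directions `Bₛ`; so one of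
these is less than `1`, and `M` is above the roots of `(1 - D_{Bₛ}) p`. As the operators commute,
the expected outer products `Aᵢ` are replaced in this way, one at a time, by outer products of
values taken with positive probability. In the end `(1 + √ε)² I` is above the roots of
`M ↦ det (M - ∑ wᵢ wᵢ*)`, which is the norm bound; by independence the chosen values occur together with positive
probability.
-/

/-! ### Univariate polynomials without roots in the closed upper half plane -/

open Polynomial in
/-- The logarithmic derivative is `∑ 1 / (0 - z)` over the roots `z`, all of which lie in the open
lower half plane. -/
theorem logDeriv_im_neg {f : ℂ[X]} (hf : ∀ z : ℂ, 0 ≤ z.im → f.eval z ≠ 0)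
    (hdeg : f.roots ≠ 0) : (f.derivative.eval 0 / f.eval 0).im < 0 := by
  rw [(IsAlgClosed.splits f).eval_derivative_div_eval_of_ne_zero (hf 0 (by simp))]
  have hroot : ∀ z ∈ f.roots, z.im < 0 := fun z hz => by
    by_contra! h
    exact hf z h (isRoot_of_mem_roots hz)
  have key : ∀ s : Multiset ℂ, (∀ z ∈ s, z.im < 0) →
      (s.map fun z => 1 / (0 - z)).sum.im ≤ 0 ∧
      (s ≠ 0 → (s.map fun z => 1 / (0 - z)).sum.im < 0) := by
    intro s
    induction s using Multiset.induction with
    | empty => simp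
    | cons a s ih =>
      intro h
      have h1 := (ih fun z hz => h z (Multiset.mem_cons_of_mem hz)).1
      have ha := h a (Multiset.mem_cons_self a s)
      have hpos : 0 < Complex.normSq a := by
        rw [Complex.normSq_pos]
        rintro rfl
        simp at ha
      have h2 : (1 / (0 - a)).im < 0 := by
        have : (1 / (0 - a)).im = a.im / Complex.normSq a := by
          simp [Complex.inv_im, neg_div]
        rw [this]
        exact div_neg_of_neg_of_pos ha hpos
      simp only [Multiset.map_cons, Multiset.sum_cons, Complex.add_im]
      constructor
      · linarith
      · intro _; linarith
  exact (key _ hroot).2 hdeg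

open Polynomial in
theorem derivative_mul_conj_im_nonpos {f : ℂ[X]} (hf : ∀ z : ℂ, 0 ≤ z.im → f.eval z ≠ 0) :
    (f.derivative.eval 0 * (starRingEnd ℂ) (f.eval 0)).im ≤ 0 := by
  have h0 := hf 0 (by simp)
  have h1 : f.derivative.eval 0 * (starRingEnd ℂ) (f.eval 0)
      = (f.derivative.eval 0 / f.eval 0) * (Complex.normSq (f.eval 0) : ℂ) := by
    rw [Complex.normSq_eq_conj_mul_self]
    field_simp
  rw [h1, Complex.im_mul_ofReal]
  apply mul_nonpos_of_nonpos_of_nonneg _ (Complex.normSq_nonneg _)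
  by_cases hr : f.roots = 0
  · rw [(IsAlgClosed.splits f).eval_derivative_div_eval_of_ne_zero h0, hr]
    simp
  · exact (logDeriv_im_neg hf hr).le

open Polynomial in
theorem derivative_ne_self_of_no_upper_root {f : ℂ[X]} (hf : ∀ z : ℂ, 0 ≤ z.im → f.eval z ≠ 0) :
    f.eval 0 - f.derivative.eval 0 ≠ 0 := by
  have h0 := hf 0 (by simp)
  intro h
  have h1 : f.derivative.eval 0 / f.eval 0 = 1 := by
    rw [div_eq_one_iff_eq h0]
    linear_combination -h
  by_cases hr : f.roots = 0
  · rw [(IsAlgClosed.splits f).eval_derivative_div_eval_of_ne_zero h0, hr] at h1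
    simp at h1
  · have := logDeriv_im_neg hf hr
    rw [h1] at this
    simp at this

open Polynomial in
/-- Moving up the imaginary axis increases the distance to every root. -/
theorem norm_eval_mul_I_mono {f : ℂ[X]} (hf : ∀ z : ℂ, 0 ≤ z.im → f.eval z ≠ 0) {a b : ℝ}
    (ha : 0 ≤ a) (hab : a ≤ b) :
    ‖f.eval (a * Complex.I)‖ ≤ ‖f.eval (b * Complex.I)‖ := by
  have hroot : ∀ z ∈ f.roots, z.im < 0 := fun z hz => by
    by_contra! h
    exact hf z h (isRoot_of_mem_roots hz)
  have key : ∀ s : Multiset ℂ, (∀ z ∈ s, z.im < 0) →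
      ‖(s.map fun z => a * Complex.I - z).prod‖ ≤ ‖(s.map fun z => b * Complex.I - z).prod‖ := by
    intro s
    induction s using Multiset.induction with
    | empty => simp
    | cons c s ih =>
      intro h
      have h1 := ih fun z hz => h z (Multiset.mem_cons_of_mem hz)
      have hc := h c (Multiset.mem_cons_self c s)
      simp only [Multiset.map_cons, Multiset.prod_cons, norm_mul]
      refine mul_le_mul ?_ h1 (norm_nonneg _) (norm_nonneg _)
      rw [Complex.norm_def, Complex.norm_def]
      apply Real.sqrt_le_sqrt
      simp only [Complex.normSq_apply, Complex.sub_re, Complex.sub_im, Complex.mul_re,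
        Complex.mul_im, Complex.ofReal_re, Complex.ofReal_im, Complex.I_re, Complex.I_im]
      nlinarith
  rw [(IsAlgClosed.splits f).eval_eq_prod_roots, (IsAlgClosed.splits f).eval_eq_prod_roots,
    norm_mul, norm_mul]
  exact mul_le_mul_of_nonneg_left (key _ hroot) (norm_nonneg _)

/-! ### Quotients mapping the upper half plane to the lower half plane -/

/-- The quotient `N / Q` maps the upper half plane into the closed lower half plane. The condition
is written without division, as `Im (N * conj Q) ≤ 0`, and so makes sense at common zeros too. -/
def PickPair (N Q : Polynomial ℝ) : Prop :=
  ∀ z : ℂ, 0 ≤ z.im → (Polynomial.aeval z N * (starRingEnd ℂ) (Polynomial.aeval z Q)).im ≤ 0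

namespace PickPair
open Polynomial

variable {N Q : ℝ[X]}

/-- The numerator of the derivative of `N / Q` is nonpositive at real points `t`: it is the
derivative at `y = 0` of `Im (N * conj Q)` at `t + iy`, a function that vanishes at `0`. -/
theorem wronskian_nonpos (h : PickPair N Q) (t : ℝ) :
    N.derivative.eval t * Q.eval t - N.eval t * Q.derivative.eval t ≤ 0 := by
  have hline : HasDerivAt (fun y : ℝ => (t : ℂ) + y * Complex.I) Complex.I 0 := by
    simpa using ((Complex.ofRealCLM.hasDerivAt (x := (0 : ℝ))).mul_const Complex.I).const_add (t : ℂ)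
  have hpoly : ∀ P : ℝ[X], HasDerivAt (fun y : ℝ => aeval ((t : ℂ) + y * Complex.I) P)
      ((P.derivative.eval t : ℝ) * Complex.I) 0 := by
    intro P
    have h1 := (P.hasDerivAt_aeval ((t : ℂ) + (0 : ℝ) * Complex.I)).comp (0 : ℝ) hline
    have h2 : aeval ((t : ℂ) + (0 : ℝ) * Complex.I) (derivative P)
        = ((P.derivative.eval t : ℝ) : ℂ) := by
      rw [Complex.ofReal_zero, zero_mul, add_zero]
      exact aeval_algebraMap_apply_eq_algebraMap_eval t P.derivative
    rw [h2] at h1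
    exact h1
  have hval : ∀ P : ℝ[X], aeval ((t : ℂ) + (0 : ℝ) * Complex.I) P = ((P.eval t : ℝ) : ℂ) := by
    intro P
    rw [Complex.ofReal_zero, zero_mul, add_zero]
    exact aeval_algebraMap_apply_eq_algebraMap_eval t P
  have hprod := Complex.imCLM.hasFDerivAt.comp_hasDerivAt (0 : ℝ) ((hpoly N).mul (hpoly Q).star)
  have hslope := hprod.tendsto_slope_zero_right
  have hle := le_of_tendsto (b := 0) hslope (Filter.eventually_of_mem self_mem_nhdsWithin
    fun y (hy : 0 < y) => by
      have h1 := h ((t : ℂ) + y * Complex.I) (by simpa using hy.le)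
      have h2 : ((aeval ((t : ℂ) + (0 : ℝ) * Complex.I) N) *
          star (aeval ((t : ℂ) + (0 : ℝ) * Complex.I) Q)).im = 0 := by
        rw [hval, hval, Complex.star_def, Complex.conj_ofReal, ← Complex.ofReal_mul,
          Complex.ofReal_im]
      simp only [Function.comp, Pi.mul_apply, zero_add, Complex.imCLM_apply]
      rw [h2, sub_zero, smul_eq_mul]
      exact mul_nonpos_of_nonneg_of_nonpos (inv_nonneg.2 hy.le) h1)
  simp only [hval] at hle
  simpa using hle

theorem of_mul_X_sub_C {τ : ℝ} (h : PickPair ((X - C τ) * N) ((X - C τ) * Q)) :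
    PickPair N Q := by
  intro z hz
  by_cases hzτ : z = τ
  · subst hzτ
    have hval : ∀ P : ℝ[X], aeval (τ : ℂ) P = ((P.eval τ : ℝ) : ℂ) := fun P =>
      aeval_algebraMap_apply_eq_algebraMap_eval τ P
    rw [hval, hval, Complex.conj_ofReal, ← Complex.ofReal_mul, Complex.ofReal_im]
  · have h1 := h z hz
    have h2 : 0 < Complex.normSq (z - τ) := Complex.normSq_pos.2 (sub_ne_zero.2 hzτ)
    have h3 : aeval z ((X - C τ) * N) * (starRingEnd ℂ) (aeval z ((X - C τ) * Q))
        = (aeval z N * (starRingEnd ℂ) (aeval z Q)) * (Complex.normSq (z - τ) : ℂ) := by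
      rw [Complex.normSq_eq_conj_mul_self]
      simp only [map_mul, map_sub, aeval_X, aeval_C, Complex.coe_algebraMap]
      ring
    rw [h3, Complex.im_mul_ofReal] at h1
    by_contra! h4
    exact absurd h1 (not_le.2 (mul_pos h4 h2))

/-- For a root `τ` of order `m`, the quotient behaves near `τ` like a constant times `(z - τ)⁻ᵐ`;
let `z` approach `τ` along the ray with direction `w`. -/
theorem im_pow_nonneg_of_root {τ : ℝ} {m : ℕ} {U : ℝ[X]}
    (h : PickPair N ((X - C τ) ^ m * U)) {w : ℂ} (hw : 0 ≤ w.im) :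
    0 ≤ N.eval τ * U.eval τ * (w ^ m).im := by
  have hval : ∀ P : ℝ[X], aeval (τ : ℂ) P = ((P.eval τ : ℝ) : ℂ) := fun P =>
      aeval_algebraMap_apply_eq_algebraMap_eval τ P
  have key : ∀ ρ : ℝ, 0 < ρ → (aeval ((τ : ℂ) + ρ * w) N * ((starRingEnd ℂ) (w ^ m) *
      (starRingEnd ℂ) (aeval ((τ : ℂ) + ρ * w) U))).im ≤ 0 := by
    intro ρ hρ
    have h1 := h ((τ : ℂ) + ρ * w) (by simpa using mul_nonneg hρ.le hw)
    have h3 : aeval ((τ : ℂ) + ρ * w) N * (starRingEnd ℂ) (aeval ((τ : ℂ) + ρ * w) ((X - C τ) ^ m * U))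
        = (aeval ((τ : ℂ) + ρ * w) N * ((starRingEnd ℂ) (w ^ m) *
      (starRingEnd ℂ) (aeval ((τ : ℂ) + ρ * w) U))) * ((ρ ^ m : ℝ) : ℂ) := by
      simp only [map_mul, map_sub, map_pow, map_add, aeval_X, aeval_C, Complex.coe_algebraMap,
        Complex.conj_ofReal, Complex.ofReal_pow]
      ring
    rw [h3, Complex.im_mul_ofReal] at h1
    by_contra! h4
    exact absurd h1 (not_le.2 (mul_pos h4 (pow_pos hρ m)))
  have hcont : Continuous fun ρ : ℝ => (aeval ((τ : ℂ) + ρ * w) N * ((starRingEnd ℂ) (w ^ m) *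
      (starRingEnd ℂ) (aeval ((τ : ℂ) + ρ * w) U))).im := by
    fun_prop
  have hlim := (hcont.tendsto 0).mono_left (nhdsWithin_le_nhds (s := Set.Ioi 0))
  have h5 := le_of_tendsto hlim (Filter.eventually_of_mem self_mem_nhdsWithin fun ρ hρ => key ρ hρ)
  rw [Complex.ofReal_zero, zero_mul, add_zero, hval, hval, Complex.conj_ofReal] at h5
  have h6 : ((N.eval τ : ℝ) : ℂ) * ((starRingEnd ℂ) (w ^ m) * ((U.eval τ : ℝ) : ℂ))
      = ((N.eval τ * U.eval τ : ℝ) : ℂ) * (starRingEnd ℂ) (w ^ m) := by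
    push_cast; ring
  rw [h6, Complex.im_ofReal_mul, Complex.conj_im] at h5
  linarith

/-- A real pole is simple: if its order is `m ≥ 2`, then `wᵐ` takes both values `±i` on the closed
upper half plane. -/
theorem rootMultiplicity_le_one {τ : ℝ} (h : PickPair N Q) (hQ : Q ≠ 0) (hN : N.eval τ ≠ 0) :
    Q.rootMultiplicity τ ≤ 1 := by
  by_contra! hm
  obtain ⟨U, hU, hUτ⟩ := exists_eq_pow_rootMultiplicity_mul_and_not_dvd Q hQ τ
  set m := Q.rootMultiplicity τ
  rw [hU] at h
  have hm' : (0 : ℝ) < m := by exact_mod_cast (by omega : 0 < m)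
  have hm2 : (2 : ℝ) ≤ m := by exact_mod_cast hm
  have hexp : ∀ θ : ℝ, 0 ≤ θ → θ ≤ Real.pi * m →
      0 ≤ N.eval τ * U.eval τ * Real.sin θ := by
    intro θ h0 h1
    have h2 : 0 ≤ (Complex.exp ((θ / m : ℝ) * Complex.I)).im := by
      rw [Complex.exp_ofReal_mul_I_im]
      apply Real.sin_nonneg_of_nonneg_of_le_pi
      · positivity
      · rwa [div_le_iff₀ hm']
    have h3 := h.im_pow_nonneg_of_root h2
    rwa [← Complex.exp_nat_mul, show (m : ℂ) * (((θ / m : ℝ) : ℂ) * Complex.I) = (θ : ℝ) * Complex.I by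
      have : (m : ℂ) ≠ 0 := by exact_mod_cast hm'.ne'
      push_cast; field_simp, Complex.exp_ofReal_mul_I_im] at h3
  have hpi := Real.pi_pos
  have h1 := hexp (Real.pi / 2) (by positivity) (by nlinarith)
  have h2 := hexp (Real.pi / 2 + Real.pi) (by positivity) (by nlinarith)
  rw [Real.sin_add_pi, Real.sin_pi_div_two] at h2
  rw [Real.sin_pi_div_two] at h1
  have h3 : N.eval τ * U.eval τ = 0 := by linarith
  rcases mul_eq_zero.1 h3 with h4 | h4
  · exact hN h4
  · exact hUτ (dvd_iff_isRoot.2 h4)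

/-- The case without common roots: the poles are simple, and Lagrange interpolation at the poles
gives the remainder of `N` modulo `Q`. -/
theorem exists_partialFraction_of_coprime (h : PickPair N Q) (hQ : Q ≠ 0) (hs : Q.Splits)
    (hroot : ∀ τ, Q.eval τ = 0 → N.eval τ ≠ 0) :
    ∃ (s : Finset ℝ) (c : ℝ → ℝ) (L : ℝ[X]), (∀ τ ∈ s, Q.eval τ = 0 ∧ 0 ≤ c τ) ∧
      ∀ t, Q.eval t ≠ 0 → N.eval t / Q.eval t = L.eval t + ∑ τ ∈ s, c τ / (t - τ) := by
  have hnodup : Q.roots.Nodup := by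
    rw [Multiset.nodup_iff_count_le_one]
    intro a
    rw [count_roots]
    by_cases ha : Q.eval a = 0
    · exact h.rootMultiplicity_le_one hQ (hroot a ha)
    · rw [rootMultiplicity_eq_zero ha]; exact zero_le_one
  set s := Q.roots.toFinset with hsdef
  have hmem : ∀ τ, τ ∈ s ↔ Q.eval τ = 0 := by
    intro τ; simp [hsdef, hQ]
  have hQnodal : Q = C Q.leadingCoeff * Lagrange.nodal s id := by
    conv_lhs => rw [hs.eq_prod_roots]
    rw [Lagrange.nodal, Finset.prod, hsdef, Multiset.toFinset_val, hnodup.dedup]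
    rfl
  have hlc : Q.leadingCoeff ≠ 0 := leadingCoeff_ne_zero.2 hQ
  set l := Q.leadingCoeff with hl
  have hmonic : (Lagrange.nodal s (id : ℝ → ℝ)).Monic := Lagrange.nodal_monic
  set R := N %ₘ Lagrange.nodal s (id : ℝ → ℝ) with hR
  set L := N /ₘ Lagrange.nodal s (id : ℝ → ℝ) with hL
  have hdiv : R + Lagrange.nodal s id * L = N := modByMonic_add_div N (Lagrange.nodal s id)
  have hRdeg : R.degree < s.card := by
    have := degree_modByMonic_lt N hmonic
    rwa [Lagrange.degree_nodal] at this
  have hinj : Set.InjOn (id : ℝ → ℝ) s := Set.injOn_id _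
  have hRinterp : R = Lagrange.interpolate s id fun i => N.eval i := by
    apply Lagrange.eq_interpolate_of_eval_eq _ hinj hRdeg
    intro i hi
    have := congrArg (eval i) hdiv
    rw [eval_add, eval_mul, show eval i (Lagrange.nodal s (id : ℝ → ℝ)) = 0 from
      Lagrange.eval_nodal_at_node (v := (id : ℝ → ℝ)) hi, zero_mul, add_zero] at this
    exact this
  refine ⟨s, fun τ => l⁻¹ * Lagrange.nodalWeight s id τ * N.eval τ, C l⁻¹ * L, ?_, ?_⟩
  · intro τ hτ
    refine ⟨(hmem τ).1 hτ, ?_⟩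
    have h1 : Q = (X - C τ) ^ 1 * (C l * Lagrange.nodal (s.erase τ) id) := by
      conv_lhs => rw [hQnodal, Lagrange.nodal_eq_mul_nodal_erase hτ]
      simp only [id]; ring
    have h2 := h
    rw [h1] at h2
    have h3 := h2.im_pow_nonneg_of_root (w := Complex.I) (by simp)
    rw [pow_one, Complex.I_im, mul_one, eval_mul, eval_C] at h3
    simp only []
    rw [Lagrange.nodalWeight_eq_eval_nodal_erase_inv]
    simp only [id]
    set u := eval τ (Lagrange.nodal (s.erase τ) (id : ℝ → ℝ))
    have h4 : l⁻¹ * u⁻¹ * eval τ N = (eval τ N * (l * u)) * ((l * u)⁻¹) ^ 2 := by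
      by_cases hu : u = 0
      · simp [hu]
      · field_simp
    rw [h4]
    positivity
  · intro t ht
    have hne : ∀ i ∈ s, t ≠ id i := by
      intro i hi hti
      exact ht (hti ▸ (hmem i).1 hi)
    have hnod : eval t (Lagrange.nodal s (id : ℝ → ℝ)) ≠ 0 := by
      intro h0
      apply ht
      rw [hQnodal, eval_mul, h0, mul_zero]
    have h1 : N.eval t = eval t (Lagrange.nodal s (id : ℝ → ℝ)) *
        (∑ i ∈ s, Lagrange.nodalWeight s id i * (t - id i)⁻¹ * N.eval i) +
        eval t (Lagrange.nodal s (id : ℝ → ℝ)) * L.eval t := by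
      conv_lhs => rw [← hdiv, eval_add, eval_mul, hRinterp]
      rw [Lagrange.eval_interpolate_not_at_node _ hne]
    rw [show Q.eval t = l * eval t (Lagrange.nodal s (id : ℝ → ℝ)) by
      conv_lhs => rw [hQnodal, eval_mul, eval_C], h1, eval_mul, eval_C]
    have h2 : ∑ τ ∈ s, l⁻¹ * Lagrange.nodalWeight s id τ * eval τ N / (t - τ) =
       l⁻¹ *  ∑ i ∈ s, Lagrange.nodalWeight s id i * (t - id i)⁻¹ * N.eval i := by
      rw [Finset.mul_sum]
      refine Finset.sum_congr rfl fun i _ => ?_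
      simp only [id, div_eq_mul_inv]; ring
    rw [h2]
    field_simp
    ring

/-- Partial fractions: real poles, nonnegative residues `c τ`, and a polynomial part `L`. -/
theorem exists_partialFraction (h : PickPair N Q) (hQ : Q ≠ 0) (hs : Q.Splits) :
    ∃ (s : Finset ℝ) (c : ℝ → ℝ) (L : ℝ[X]), (∀ τ ∈ s, Q.eval τ = 0 ∧ 0 ≤ c τ) ∧
      ∀ t, Q.eval t ≠ 0 → N.eval t / Q.eval t = L.eval t + ∑ τ ∈ s, c τ / (t - τ) := by
  induction hn : Q.natDegree using Nat.strong_induction_on generalizing N Q with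
  | _ n ih =>
  by_cases hroot : ∀ τ, Q.eval τ = 0 → N.eval τ ≠ 0
  · exact h.exists_partialFraction_of_coprime hQ hs hroot
  · push Not at hroot
    obtain ⟨τ, hQτ, hNτ⟩ := hroot
    obtain ⟨Q₁, rfl⟩ := dvd_iff_isRoot.2 hQτ
    obtain ⟨N₁, rfl⟩ := dvd_iff_isRoot.2 hNτ
    have hQ₁ : Q₁ ≠ 0 := right_ne_zero_of_mul hQ
    have hdeg : Q₁.natDegree < n := by
      rw [← hn, natDegree_mul (X_sub_C_ne_zero τ) hQ₁, natDegree_X_sub_C]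
      omega
    obtain ⟨s, c, L, h1, h2⟩ := ih _ hdeg h.of_mul_X_sub_C hQ₁
      (hs.of_dvd hQ (dvd_mul_left _ _)) rfl
    refine ⟨s, c, L, fun σ hσ => ⟨?_, (h1 σ hσ).2⟩, fun t ht => ?_⟩
    · rw [eval_mul, (h1 σ hσ).1, mul_zero]
    · rw [eval_mul] at ht
      rw [← h2 t (right_ne_zero_of_mul ht), eval_mul, eval_mul,
        mul_div_mul_left _ _ (left_ne_zero_of_mul ht)]

theorem antitoneOn_div (h : PickPair N Q) {a : ℝ} (hQ : ∀ t, a ≤ t → 0 < Q.eval t) :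
    AntitoneOn (fun t => N.eval t / Q.eval t) (Set.Ici a) := by
  refine antitoneOn_of_hasDerivWithinAt_nonpos (f' := fun t =>
    (N.derivative.eval t * Q.eval t - N.eval t * Q.derivative.eval t) / Q.eval t ^ 2)
    (convex_Ici a) ?_ ?_ ?_
  · exact N.continuous.continuousOn.div Q.continuous.continuousOn fun t ht => (hQ t ht).ne'
  · intro t ht
    rw [interior_Ici] at ht
    exact ((N.hasDerivAt t).div (Q.hasDerivAt t) (hQ t (le_of_lt ht)).ne').hasDerivWithinAt
  · intro t _
    exact div_nonpos_of_nonpos_of_nonneg (h.wronskian_nonpos t) (sq_nonneg _)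

/-- Convexity on `[0, ∞)`, in the form that the tangent at `t` lies below the graph at `0`. Every
term `c / (t - τ)` of the partial fraction expansion has `c ≥ 0` and `τ < 0`. -/
theorem tangent_le (h : PickPair N Q) (hs : Q.Splits) (hQ : ∀ t, 0 ≤ t → 0 < Q.eval t)
    (hN : ∀ t, 0 ≤ t → 0 ≤ N.eval t) {t : ℝ} (ht : 0 ≤ t) :
    N.eval t / Q.eval t - t *
      ((N.derivative.eval t * Q.eval t - N.eval t * Q.derivative.eval t) / Q.eval t ^ 2) ≤
      N.eval 0 / Q.eval 0 := by
  have hQ0 : Q ≠ 0 := by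
    rintro rfl
    simpa using hQ 0 le_rfl
  obtain ⟨s, c, L, hsc, hpf⟩ := h.exists_partialFraction hQ0 hs
  have hneg : ∀ τ ∈ s, τ < 0 := by
    intro τ hτ
    by_contra! h0
    exact (hQ τ h0).ne' (hsc τ hτ).1
  have hanti := h.antitoneOn_div hQ
  -- the polynomial part is bounded on the half-line, hence constant
  have hLconst : L.degree ≤ 0 := by
    rw [← isBoundedUnder_abs_atTop_iff]
    refine ⟨N.eval 0 / Q.eval 0 + ∑ τ ∈ s, c τ / (0 - τ), ?_⟩
    rw [Filter.eventually_map]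
    filter_upwards [Filter.eventually_ge_atTop (0 : ℝ)] with x hx
    have h1 := hpf x (hQ x hx).ne'
    have h2 : N.eval x / Q.eval x ≤ N.eval 0 / Q.eval 0 := hanti (Set.mem_Ici.2 le_rfl) hx hx
    have h3 : 0 ≤ N.eval x / Q.eval x := div_nonneg (hN x hx) (hQ x hx).le
    have h4 : 0 ≤ ∑ τ ∈ s, c τ / (x - τ) := Finset.sum_nonneg fun τ hτ =>
      div_nonneg (hsc τ hτ).2 (by linarith [hneg τ hτ])
    have h5 : ∑ τ ∈ s, c τ / (x - τ) ≤ ∑ τ ∈ s, c τ / (0 - τ) := Finset.sum_le_sum fun τ hτ =>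
      div_le_div_of_nonneg_left (hsc τ hτ).2 (by linarith [hneg τ hτ]) (by linarith)
    rw [abs_le]
    constructor <;> linarith
  rw [eq_C_of_degree_le_zero hLconst] at hpf
  simp only [eval_C] at hpf
  have hder : (N.derivative.eval t * Q.eval t - N.eval t * Q.derivative.eval t) / Q.eval t ^ 2
      = ∑ τ ∈ s, -(c τ / (t - τ) ^ 2) := by
    have h1 := (N.hasDerivAt t).div (Q.hasDerivAt t) (hQ t ht).ne'
    have h2 : HasDerivAt (fun x => L.coeff 0 + ∑ τ ∈ s, c τ / (x - τ))
        (∑ τ ∈ s, -(c τ / (t - τ) ^ 2)) t := by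
      refine HasDerivAt.const_add _ (HasDerivAt.fun_sum fun τ hτ => ?_)
      have h3 := (hasDerivAt_const t (c τ)).div ((hasDerivAt_id t).sub_const τ)
        (by simpa using (by linarith [hneg τ hτ] : t - τ ≠ 0))
      refine h3.congr_deriv ?_
      simp; ring
    refine h1.unique (h2.congr_of_eventuallyEq ?_)
    filter_upwards [Q.continuous.continuousAt.eventually_ne (hQ t ht).ne'] with x hx
    exact hpf x hx
  rw [hder, hpf t (hQ t ht).ne', hpf 0 (hQ 0 le_rfl).ne', Finset.mul_sum, add_sub_assoc,
    ← Finset.sum_sub_distrib]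
  gcongr with τ hτ
  have hu : 0 < -τ := by linarith [hneg τ hτ]
  have htu : 0 < t - τ := by linarith
  have h6 : c τ / (0 - τ) - (c τ / (t - τ) - t * -(c τ / (t - τ) ^ 2))
      = c τ * (t ^ 2 / ((-τ) * (t - τ) ^ 2)) := by
    have := hu.ne'
    have h' : τ ≠ 0 := by linarith
    rw [zero_sub]
    field_simp
    ring
  have h7 : 0 ≤ c τ * (t ^ 2 / ((-τ) * (t - τ) ^ 2)) :=
    mul_nonneg (hsc τ hτ).2 (by positivity)
  linarith

end PickPair

/-! ### Stable polynomial functions on matrices -/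

/-- Polynomial functions on complex `n × n` matrices, as polynomials in the entries. -/
abbrev MatPoly (n : Type*) := MvPolynomial (n × n) ℂ

namespace MatPoly
open Matrix
open scoped ComplexOrder

variable {n : Type*}

/-- The value of `p` at the matrix `M`. -/
noncomputable def ev (p : MatPoly n) (M : Matrix n n ℂ) : ℂ :=
  MvPolynomial.eval (fun ij => M ij.1 ij.2) p

/-- The derivative in the direction of the matrix `A`. -/
noncomputable def dir (A : Matrix n n ℂ) : Derivation ℂ (MatPoly n) (MatPoly n) :=
  MvPolynomial.mkDerivation ℂ fun ij => MvPolynomial.C (A ij.1 ij.2)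

/-- The restriction of `p` to the line `z ↦ M + z A`, as a univariate polynomial. -/
noncomputable def line (p : MatPoly n) (M A : Matrix n n ℂ) : Polynomial ℂ :=
  MvPolynomial.aeval
    (fun ij => Polynomial.C (M ij.1 ij.2) + Polynomial.C (A ij.1 ij.2) * Polynomial.X) p

/-- The operator `1 - D_A`, where `D_A` is the derivative in the direction `A`. -/
noncomputable def subDir (A : Matrix n n ℂ) (p : MatPoly n) : MatPoly n := p - dir A p

theorem eval_line (p : MatPoly n) (M A : Matrix n n ℂ) (z : ℂ) :
    (p.line M A).eval z = p.ev (M + z • A) := by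
  induction p using MvPolynomial.induction_on with
  | C a => simp [line, ev]
  | add p q hp hq =>
    simp only [line, ev, map_add, Polynomial.eval_add] at *
    rw [hp, hq]
  | mul_X p i hp =>
    simp only [line, ev, map_mul, Polynomial.eval_mul] at *
    rw [hp]
    simp only [MvPolynomial.aeval_X, MvPolynomial.eval_X, Polynomial.eval_add, Polynomial.eval_mul,
      Polynomial.eval_C, Polynomial.eval_X, Matrix.add_apply, Matrix.smul_apply, smul_eq_mul]
    ring

theorem derivative_line (p : MatPoly n) (M A : Matrix n n ℂ) :
    Polynomial.derivative (p.line M A) = (dir A p).line M A := by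
  induction p using MvPolynomial.induction_on with
  | C a => simp [line, dir]
  | add p q hp hq =>
    simp only [line, map_add] at *
    rw [hp, hq]
  | mul_X p i hp =>
    simp only [line, map_mul, Derivation.leibniz, map_add, smul_eq_mul, Polynomial.derivative_mul] at *
    rw [hp]
    simp [dir, MvPolynomial.mkDerivation_X]
    ring

theorem dir_comm (A B : Matrix n n ℂ) (p : MatPoly n) : dir A (dir B p) = dir B (dir A p) := by
  have h : ⁅dir A, dir B⁆ = 0 := by
    apply MvPolynomial.derivation_ext
    intro i
    simp [dir, Derivation.commutator_apply, MvPolynomial.mkDerivation_X]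
  have := DFunLike.congr_fun h p
  rw [Derivation.commutator_apply] at this
  exact sub_eq_zero.1 this

theorem subDir_comm (A B : Matrix n n ℂ) (p : MatPoly n) :
    subDir A (subDir B p) = subDir B (subDir A p) := by
  simp only [subDir, map_sub, dir_comm A B]
  ring

theorem dir_add (A B : Matrix n n ℂ) (p : MatPoly n) : dir (A + B) p = dir A p + dir B p := by
  have h : dir (A + B) = dir A + dir B := by
    apply MvPolynomial.derivation_ext
    intro i
    simp [dir, MvPolynomial.mkDerivation_X]
  rw [h]; rfl

theorem dir_smul (a : ℂ) (A : Matrix n n ℂ) (p : MatPoly n) : dir (a • A) p = a • dir A p := by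
  have h : dir (a • A) = a • dir A := by
    apply MvPolynomial.derivation_ext
    intro i
    simp [dir, MvPolynomial.mkDerivation_X, MvPolynomial.smul_eq_C_mul]
  rw [h]; rfl

theorem ev_sub (p q : MatPoly n) (M : Matrix n n ℂ) : (p - q).ev M = p.ev M - q.ev M := by
  simp [ev]

theorem ev_subDir (p : MatPoly n) (A M : Matrix n n ℂ) :
    (subDir A p).ev M = p.ev M - (dir A p).ev M :=
  ev_sub _ _ _

/-- A complex polynomial that is real at real points has real coefficients. -/
theorem exists_map_ofReal_eq {f : Polynomial ℂ} (hf : ∀ t : ℝ, (f.eval (t : ℂ)).im = 0) :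
    ∃ g : Polynomial ℝ, g.map Complex.ofRealHom = f := by
  have h1 : f.map (starRingEnd ℂ) = f := by
    apply Polynomial.eq_of_infinite_eval_eq
    refine (Set.infinite_range_of_injective Complex.ofReal_injective).mono ?_
    rintro _ ⟨t, rfl⟩
    have h2 := Polynomial.eval_map_apply (p := f) (starRingEnd ℂ) (t : ℂ)
    rw [Complex.conj_ofReal, Complex.conj_eq_iff_im.2 (hf t)] at h2
    exact h2
  have h3 : f ∈ Polynomial.lifts Complex.ofRealHom := by
    rw [Polynomial.lifts_iff_coeff_lifts]
    intro k
    have h4 := congrArg (fun q => q.coeff k) h1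
    simp only [Polynomial.coeff_map] at h4
    exact ⟨_, Complex.conj_eq_iff_re.1 h4⟩
  exact (Polynomial.mem_lifts _).1 h3

theorem isHermitian_ofReal_smul {A : Matrix n n ℂ} (hA : A.IsHermitian) (t : ℝ) :
    ((t : ℂ) • A).IsHermitian := by
  rw [Matrix.IsHermitian, conjTranspose_smul, hA.eq, Complex.star_def, Complex.conj_ofReal]

theorem posSemidef_ofReal_smul {A : Matrix n n ℂ} (hA : A.PosSemidef) {t : ℝ} (ht : 0 ≤ t) :
    ((t : ℂ) • A).PosSemidef :=
  hA.smul (by exact_mod_cast ht)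

/-- `p` takes real values on Hermitian matrices. -/
def IsReal (p : MatPoly n) : Prop := ∀ X : Matrix n n ℂ, X.IsHermitian → (p.ev X).im = 0

theorem IsReal.exists_line {p : MatPoly n} (hp : p.IsReal) {M A : Matrix n n ℂ} (hM : M.IsHermitian)
    (hA : A.IsHermitian) : ∃ Q : Polynomial ℝ, Q.map Complex.ofRealHom = p.line M A :=
  exists_map_ofReal_eq fun t => by
    rw [eval_line]
    exact hp _ (hM.add (isHermitian_ofReal_smul hA t))

theorem IsReal.dir {p : MatPoly n} (hp : p.IsReal) {A : Matrix n n ℂ} (hA : A.IsHermitian) :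
    IsReal (dir A p) := by
  intro X hX
  obtain ⟨Q, hQ⟩ := hp.exists_line hX hA
  have h := congrArg (fun q => (Polynomial.derivative q).eval ((0 : ℝ) : ℂ)) hQ
  simp only [derivative_line, eval_line, Polynomial.derivative_map] at h
  rw [show ((0 : ℝ) : ℂ) = Complex.ofRealHom 0 from rfl, Polynomial.eval_map_apply] at h
  simp only [Complex.ofRealHom_eq_coe, Complex.ofReal_zero, zero_smul, add_zero] at h
  rw [← h, Complex.ofReal_im]

theorem IsReal.subDir {p : MatPoly n} (hp : p.IsReal) {A : Matrix n n ℂ} (hA : A.IsHermitian) :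
    IsReal (subDir A p) := by
  intro X hX
  rw [ev_subDir, Complex.sub_im, hp X hX, hp.dir hA X hX, sub_zero]

/-- Values at `X + iY` are limits of values at `X + i(Y + η)`, where `Y + η` is positive definite if
`Y` is positive semidefinite. -/
theorem tendsto_ev [DecidableEq n] (p : MatPoly n) (X Y : Matrix n n ℂ) :
    Filter.Tendsto (fun η : ℝ => p.ev (X + Complex.I • (Y + (η : ℂ) • (1 : Matrix n n ℂ))))
      (nhdsWithin 0 (Set.Ioi 0)) (nhds (p.ev (X + Complex.I • Y))) := by
  have h1 : Continuous fun η : ℝ => (p.line (X + Complex.I • Y) 1).eval ((η : ℂ) * Complex.I) := by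
    fun_prop
  have h2 := (h1.tendsto 0).mono_left (nhdsWithin_le_nhds (s := Set.Ioi 0))
  simp only [eval_line] at h2
  rw [Complex.ofReal_zero, zero_mul, zero_smul, add_zero] at h2
  refine h2.congr fun η => ?_
  congr 1
  module

theorem posDef_add_smul_one [DecidableEq n] {Y : Matrix n n ℂ} (hY : Y.PosSemidef)
    {η : ℝ} (hη : 0 < η) :
    (Y + (η : ℂ) • (1 : Matrix n n ℂ)).PosDef :=
  PosDef.posSemidef_add hY (PosDef.one.smul (by exact_mod_cast hη))

/-- `p` is real stable: real on Hermitian matrices, and without zeros among the matrices whose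
Hermitian imaginary part is positive definite. -/
structure IsStable [Fintype n] (p : MatPoly n) : Prop where
  isReal : p.IsReal
  ev_ne_zero : ∀ X Y : Matrix n n ℂ, X.IsHermitian → Y.PosDef → p.ev (X + Complex.I • Y) ≠ 0

namespace IsStable

theorem add_smul_eq (X Y A : Matrix n n ℂ) (z : ℂ) :
    X + Complex.I • Y + z • A =
      (X + ((z.re : ℝ) : ℂ) • A) + Complex.I • (Y + ((z.im : ℝ) : ℂ) • A) := by
  conv_lhs => rw [← Complex.re_add_im z]
  module

variable [Fintype n] {p : MatPoly n}

theorem line_ne_zero (hp : p.IsStable) {X Y A : Matrix n n ℂ} (hX : X.IsHermitian) (hY : Y.PosDef)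
    (hA : A.PosSemidef) (z : ℂ) (hz : 0 ≤ z.im) :
    (p.line (X + Complex.I • Y) A).eval z ≠ 0 := by
  rw [eval_line, add_smul_eq]
  exact hp.ev_ne_zero _ _ (hX.add (isHermitian_ofReal_smul hA.isHermitian _))
    (hY.add_posSemidef (posSemidef_ofReal_smul hA hz))

theorem subDir (hp : p.IsStable) {A : Matrix n n ℂ} (hA : A.PosSemidef) :
    (subDir A p).IsStable where
  isReal := hp.isReal.subDir hA.isHermitian
  ev_ne_zero X Y hX hY := by
    have h := derivative_ne_self_of_no_upper_root (hp.line_ne_zero hX hY hA)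
    rwa [derivative_line, eval_line, eval_line, zero_smul, add_zero, ← ev_subDir] at h

variable [DecidableEq n]

/-- The condition `Im (D_A p / p) ≤ 0`, without division, at matrices with positive semidefinite
imaginary part. -/
theorem dir_mul_conj_im_nonpos (hp : p.IsStable) {X Y A : Matrix n n ℂ} (hX : X.IsHermitian)
    (hY : Y.PosSemidef) (hA : A.PosSemidef) :
    ((dir A p).ev (X + Complex.I • Y) * (starRingEnd ℂ) (p.ev (X + Complex.I • Y))).im ≤ 0 := by
  have hlim := Complex.continuous_im.continuousAt.tendsto.comp ((tendsto_ev (dir A p) X Y).mul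
    (Complex.continuous_conj.continuousAt.tendsto.comp (tendsto_ev p X Y)))
  refine le_of_tendsto hlim (Filter.eventually_of_mem self_mem_nhdsWithin fun η (hη : 0 < η) => ?_)
  have h := derivative_mul_conj_im_nonpos
    (hp.line_ne_zero hX (posDef_add_smul_one hY hη) hA)
  rwa [derivative_line, eval_line, eval_line, zero_smul, add_zero] at h

theorem norm_ev_mono (hp : p.IsStable) {X Y A : Matrix n n ℂ} (hX : X.IsHermitian)
    (hY : Y.PosSemidef) (hA : A.PosSemidef) {a b : ℝ} (ha : 0 ≤ a) (hab : a ≤ b) :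
    ‖p.ev (X + Complex.I • (Y + (a : ℂ) • A))‖ ≤ ‖p.ev (X + Complex.I • (Y + (b : ℂ) • A))‖ := by
  refine le_of_tendsto_of_tendsto (tendsto_ev p X _).norm (tendsto_ev p X _).norm
    (Filter.eventually_of_mem self_mem_nhdsWithin fun η (hη : 0 < η) => ?_)
  have h := norm_eval_mul_I_mono (hp.line_ne_zero hX (posDef_add_smul_one hY hη) hA) ha hab
  rw [eval_line, eval_line] at h
  have hconv : ∀ c : ℝ, X + Complex.I • (Y + (c : ℂ) • A + (η : ℂ) • (1 : Matrix n n ℂ)) =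
      X + Complex.I • (Y + (η : ℂ) • (1 : Matrix n n ℂ)) + ((c : ℂ) * Complex.I) • A := by
    intro c; module
  simp only [hconv]
  exact h

/-- A stable polynomial that does not vanish identically on a line with Hermitian base point and
positive semidefinite direction has only real roots there. -/
theorem line_splits (hp : p.IsStable) {M A : Matrix n n ℂ} (hM : M.IsHermitian)
    (hA : A.PosSemidef) {Q : Polynomial ℝ} (hQ : Q.map Complex.ofRealHom = p.line M A)
    (hQ0 : Q ≠ 0) : Q.Splits := by
  have hline0 : p.line M A ≠ 0 := by
    rw [← hQ]
    exact (Polynomial.map_ne_zero_iff Complex.ofRealHom.injective).2 hQ0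
  have hup : ∀ z : ℂ, (p.line M A).eval z = 0 → z.im ≤ 0 := by
    intro z hz
    by_contra! him
    -- `|p|` does not decrease in the direction `iA`, so a root at height `b > 0` forces roots at
    -- all heights in `[0, b]`
    apply hline0
    apply Polynomial.eq_zero_of_infinite_isRoot
    have hinj : Function.Injective fun y : ℝ => (z.re : ℂ) + y * Complex.I := by
      intro y y' h
      simpa using congrArg Complex.im h
    refine ((Set.Icc_infinite him).image hinj.injOn).mono ?_
    rintro _ ⟨y, ⟨hy0, hy1⟩, rfl⟩
    have h1 := hp.norm_ev_mono (hM.add (isHermitian_ofReal_smul hA.isHermitian z.re))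
      PosSemidef.zero hA hy0 hy1
    have hconv : ∀ y : ℝ, p.ev (M + (z.re : ℂ) • A + Complex.I • ((0 : Matrix n n ℂ) + (y : ℂ) • A)) =
        (p.line M A).eval ((z.re : ℂ) + y * Complex.I) := by
      intro y
      rw [eval_line]
      congr 1
      module
    rw [hconv, hconv, Complex.re_add_im, hz, norm_zero] at h1
    exact norm_le_zero_iff.1 h1
  have hreal : ∀ z : ℂ, (p.line M A).eval z = 0 → z.im = 0 := by
    intro z hz
    refine le_antisymm (hup z hz) ?_
    have h2 : (p.line M A).eval ((starRingEnd ℂ) z) = 0 := by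
      rw [← hQ, Polynomial.eval_map] at hz ⊢
      have h3 := Polynomial.hom_eval₂ Q Complex.ofRealHom (starRingEnd ℂ) z
      rw [hz, map_zero] at h3
      rw [h3]
      congr 1
      ext x
      simp
    simpa using hup _ h2
  refine Polynomial.Splits.of_splits_map Complex.ofRealHom (IsAlgClosed.splits _) fun a ha => ?_
  have h4 := hreal a (by rw [← hQ]; exact Polynomial.isRoot_of_mem_roots ha)
  exact ⟨a.re, Complex.ext (by simp) (by simpa using h4.symm)⟩

/-- Along a line, `D_A p` and `p` form a Pick pair. -/
theorem exists_pickPair (hp : p.IsStable) {M A B : Matrix n n ℂ} (hM : M.IsHermitian)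
    (hA : A.PosSemidef) (hB : B.PosSemidef) :
    ∃ N Q : Polynomial ℝ, PickPair N Q ∧ (Q ≠ 0 → Q.Splits) ∧
      Q.map Complex.ofRealHom = p.line M B ∧ N.map Complex.ofRealHom = (dir A p).line M B := by
  obtain ⟨Q, hQ⟩ := hp.isReal.exists_line hM hB.isHermitian
  obtain ⟨N, hN⟩ := (hp.isReal.dir hA.isHermitian).exists_line hM hB.isHermitian
  refine ⟨N, Q, fun z hz => ?_, hp.line_splits hM hB hQ, hQ, hN⟩
  have hae : ∀ P : Polynomial ℝ, Polynomial.aeval z P = (P.map Complex.ofRealHom).eval z := by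
    intro P
    exact (Polynomial.eval_map_algebraMap P z).symm
  have h := hp.dir_mul_conj_im_nonpos (hM.add (isHermitian_ofReal_smul hB.isHermitian z.re))
    (posSemidef_ofReal_smul hB hz) hA
  rw [hae, hae, hQ, hN, eval_line, eval_line]
  have h2 := add_smul_eq M 0 B z
  rw [smul_zero, add_zero, zero_add] at h2
  rwa [h2]

end IsStable
end MatPoly

/-! ### The barrier of a stable polynomial above its roots -/

namespace Polynomial

theorem eval_derivative_div_eval_nonneg {Q : ℝ[X]} (hs : Q.Splits)
    (hQ : ∀ t, 0 ≤ t → 0 < Q.eval t) : 0 ≤ Q.derivative.eval 0 / Q.eval 0 := by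
  have hQ0 : Q ≠ 0 := by
    rintro rfl
    simpa using hQ 0 le_rfl
  rw [hs.eval_derivative_div_eval_of_ne_zero (hQ 0 le_rfl).ne']
  refine Multiset.sum_nonneg fun x hx => ?_
  obtain ⟨τ, hτ, rfl⟩ := Multiset.mem_map.1 hx
  have h1 : τ < 0 := by
    by_contra! h
    exact (hQ τ h).ne' (isRoot_of_mem_roots hτ)
  exact div_nonneg zero_le_one (by linarith)

theorem tendsto_derivative_div (Q : ℝ[X]) :
    Filter.Tendsto (fun t => Q.derivative.eval t / Q.eval t) Filter.atTop (nhds 0) := by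
  by_cases h : Q.natDegree = 0
  · rw [derivative_of_natDegree_zero h]
    simp
  · exact div_tendsto_atTop_zero_of_degree_lt _ _ (degree_derivative_lt fun h0 => h (by simp [h0]))

end Polynomial

namespace MatPoly
open Matrix
open scoped ComplexOrder

variable {n : Type*}

/-- The real part of the value of `p` at `M`; for stable `p` and Hermitian `M` it is the value. -/
noncomputable def val (p : MatPoly n) (M : Matrix n n ℂ) : ℝ := (p.ev M).re

/-- `M` lies above the roots of `p`: `p` is positive on `M + Y` for all positive semidefinite `Y`.
-/
def Above [Fintype n] (p : MatPoly n) (M : Matrix n n ℂ) : Prop :=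
  ∀ Y : Matrix n n ℂ, Y.PosSemidef → 0 < p.val (M + Y)

/-- The barrier function `D_A p / p`. It is meaningful above the roots of `p`, where `p` is
positive. -/
noncomputable def barrier (A : Matrix n n ℂ) (p : MatPoly n) (M : Matrix n n ℂ) : ℝ :=
  (dir A p).val M / p.val M

theorem val_subDir (p : MatPoly n) (A M : Matrix n n ℂ) :
    (subDir A p).val M = p.val M - (dir A p).val M := by
  simp [val, ev_subDir]

theorem val_eq_eval {p : MatPoly n} {M B : Matrix n n ℂ} {Q : Polynomial ℝ}
    (hQ : Q.map Complex.ofRealHom = p.line M B) (t : ℝ) :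
    p.val (M + (t : ℂ) • B) = Q.eval t := by
  have h := congrArg (fun q => q.eval (t : ℂ)) hQ
  simp only [eval_line] at h
  rw [val, ← h, show (t : ℂ) = Complex.ofRealHom t from rfl, Polynomial.eval_map_apply]
  simp

theorem Above.add [Fintype n] {p : MatPoly n} {M Y : Matrix n n ℂ} (h : p.Above M)
    (hY : Y.PosSemidef) : p.Above (M + Y) := fun Z hZ => by
  rw [add_assoc]
  exact h _ (hY.add hZ)

theorem Above.val_pos [Fintype n] {p : MatPoly n} {M : Matrix n n ℂ} (h : p.Above M) :
    0 < p.val M := by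
  simpa using h 0 PosSemidef.zero

theorem Above.val_subDir_pos_iff [Fintype n] {p : MatPoly n} {A M : Matrix n n ℂ} (h : p.Above M) :
    0 < (subDir A p).val M ↔ barrier A p M < 1 := by
  rw [val_subDir, barrier, div_lt_one h.val_pos, sub_pos]

namespace IsStable

variable [Fintype n] [DecidableEq n] {p : MatPoly n}

/-- Along a line, `p`, `D_A p` and their derivatives in the direction of the line are the values of
a Pick pair of real polynomials and of their derivatives. -/
theorem exists_eval (hp : p.IsStable) {M A B : Matrix n n ℂ} (hM : M.IsHermitian)
    (hA : A.PosSemidef) (hB : B.PosSemidef) :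
    ∃ N Q : Polynomial ℝ, PickPair N Q ∧ (Q ≠ 0 → Q.Splits) ∧
      (∀ t : ℝ, p.val (M + (t : ℂ) • B) = Q.eval t) ∧
      (∀ t : ℝ, (dir A p).val (M + (t : ℂ) • B) = N.eval t) ∧
      (∀ t : ℝ, (dir B p).val (M + (t : ℂ) • B) = Q.derivative.eval t) ∧
      (∀ t : ℝ, (dir B (dir A p)).val (M + (t : ℂ) • B) = N.derivative.eval t) := by
  obtain ⟨N, Q, h, hs, hQ, hN⟩ := hp.exists_pickPair hM hA hB
  refine ⟨N, Q, h, hs, val_eq_eval hQ, val_eq_eval hN, val_eq_eval ?_, val_eq_eval ?_⟩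
  · rw [← derivative_line, ← hQ, Polynomial.derivative_map]
  · rw [← derivative_line, ← hN, Polynomial.derivative_map]

/-- Along its own direction, the barrier is `∑ 1 / (t - τ)` over the roots `τ`, which are negative.
-/
theorem barrier_nonneg (hp : p.IsStable) {M A : Matrix n n ℂ} (hM : M.IsHermitian)
    (hA : A.PosSemidef) (h : p.Above M) : 0 ≤ barrier A p M := by
  obtain ⟨N, Q, -, hs, hQ, -, hQ', -⟩ := hp.exists_eval hM hA hA
  have hpos : ∀ t, 0 ≤ t → 0 < Q.eval t := fun t ht => by
    rw [← hQ]; exact h _ (posSemidef_ofReal_smul hA ht)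
  have h0 : Q ≠ 0 := by
    rintro rfl
    simpa using hpos 0 le_rfl
  have h1 := Polynomial.eval_derivative_div_eval_nonneg (hs h0) hpos
  rw [← hQ', ← hQ] at h1
  simpa [barrier] using h1

theorem barrier_add_le (hp : p.IsStable) {M A B : Matrix n n ℂ} (hM : M.IsHermitian)
    (hA : A.PosSemidef) (hB : B.PosSemidef) (h : p.Above M) :
    barrier A p (M + B) ≤ barrier A p M := by
  obtain ⟨N, Q, hNQ, -, hQ, hN, -, -⟩ := hp.exists_eval hM hA hB
  have hpos : ∀ t, 0 ≤ t → 0 < Q.eval t := fun t ht => by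
    rw [← hQ]; exact h _ (posSemidef_ofReal_smul hB ht)
  have h1 := hNQ.antitoneOn_div hpos (Set.mem_Ici.2 le_rfl) (Set.mem_Ici.2 zero_le_one) zero_le_one
  simp only [← hQ, ← hN] at h1
  simpa [barrier] using h1

theorem above_subDir_of_barrier_lt (hp : p.IsStable) {M A : Matrix n n ℂ} (hM : M.IsHermitian)
    (hA : A.PosSemidef) (h : p.Above M) (hlt : barrier A p M < 1) : (MatPoly.subDir A p).Above M :=
  fun _ hY => (h.add hY).val_subDir_pos_iff.2 ((hp.barrier_add_le hM hA hY h).trans_lt hlt)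

/-- If the barrier in direction `C` is at most `1 - 1/δ`, then the shift by `δ C` stays above the
roots of `(1 - D_C) p` and increases no barrier. The new barrier is `Φ - Φ' / (1 - Φ_C)`, where `Φ`
is the old one and `Φ' ≤ 0` its derivative in direction `C`, both at `M + δ C`. Here `1 / (1 - Φ_C)`
is at most `δ`, and `Φ - δ Φ'` is at most the old barrier at `M` by convexity. -/
theorem above_subDir (hp : p.IsStable) {M C : Matrix n n ℂ} (hM : M.IsHermitian)
    (hC : C.PosSemidef) (h : p.Above M) {δ : ℝ} (hδ : 0 < δ) (hb : barrier C p M ≤ 1 - 1 / δ) :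
    (MatPoly.subDir C p).Above (M + (δ : ℂ) • C) ∧ ∀ A : Matrix n n ℂ, A.PosSemidef →
      barrier A (MatPoly.subDir C p) (M + (δ : ℂ) • C) ≤ barrier A p M := by
  have hδC := posSemidef_ofReal_smul hC hδ.le
  have hle := hp.barrier_add_le hM hC hδC h
  have hδ1 : 0 < 1 / δ := by positivity
  refine ⟨hp.above_subDir_of_barrier_lt (hM.add hδC.isHermitian) hC (h.add hδC) (by linarith),
    fun A hA => ?_⟩
  obtain ⟨N, Q, hNQ, hs, hQ, hN, hQ', hN'⟩ := hp.exists_eval hM hA hC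
  have hpos : ∀ t, 0 ≤ t → 0 < Q.eval t := fun t ht => by
    rw [← hQ]; exact h _ (posSemidef_ofReal_smul hC ht)
  have h0 : Q ≠ 0 := by
    rintro rfl
    simpa using hpos 0 le_rfl
  have hnn : ∀ t, 0 ≤ t → 0 ≤ N.eval t := fun t ht => by
    have hY := posSemidef_ofReal_smul hC ht
    have h1 := hp.barrier_nonneg (hM.add hY.isHermitian) hA (h.add hY)
    rw [barrier, hQ, hN] at h1
    have h2 := mul_nonneg h1 (hpos t ht).le
    rwa [div_mul_cancel₀ _ (hpos t ht).ne'] at h2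
  have htan := hNQ.tangent_le (hs h0) hpos hnn hδ.le
  have hw := hNQ.wronskian_nonpos δ
  have hM0 : barrier A p M = N.eval 0 / Q.eval 0 := by
    rw [← hQ, ← hN]; simp [barrier]
  rw [barrier, hQ, hQ'] at hle
  rw [hM0, barrier, val_subDir, MatPoly.subDir, map_sub, dir_comm A C]
  have hsub : (dir A p - dir C (dir A p)).val (M + (δ : ℂ) • C)
      = N.eval δ - N.derivative.eval δ := by
    rw [← hN, ← hN', val, ev_sub]; rfl
  rw [hsub, hQ, hQ']
  refine le_trans ?_ htan
  have hq := hpos δ hδ.le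
  set q := Q.eval δ
  set q' := Q.derivative.eval δ
  set u := N.eval δ
  set u' := N.derivative.eval δ
  have h2 : q' / q ≤ 1 - 1 / δ := hle.trans hb
  -- the new barrier is `u / q - w / (1 - q' / q)` with `w ≤ 0` the slope of the old one
  have h3 : 1 / δ ≤ (q - q') / q := by rw [sub_div, div_self hq.ne']; linarith
  have hqq : 0 < q - q' := by
    have := hδ1.trans_le h3
    exact (div_pos_iff_of_pos_right hq).1 this
  have h4 : q ≤ δ * (q - q') := by
    rw [div_le_div_iff₀ hδ hq] at h3; linarith
  have h5 : (u - u') / (q - q') = u / q - (q / (q - q')) * ((u' * q - u * q') / q ^ 2) := by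
    field_simp
    ring
  rw [h5]
  have h6 : q / (q - q') ≤ δ := (div_le_iff₀ hqq).2 h4
  have h7 : (u' * q - u * q') / q ^ 2 ≤ 0 := div_nonpos_of_nonpos_of_nonneg hw (sq_nonneg _)
  nlinarith

/-- A matrix above the roots of `(1 - D_A) p` is above those of `p`. Otherwise let `y` be the last
point of a ray from `M + Y` in direction `1` with `p ≤ 0`: there `D_A p < p ≤ 0`, so that the
barrier in direction `A` is negative just after `y`. It does not increase along the ray, but is
nonnegative far out. -/
theorem above_of_above_subDir (hp : p.IsStable) {M A : Matrix n n ℂ} (hM : M.IsHermitian)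
    (hA : A.PosSemidef) (h : (MatPoly.subDir A p).Above M) {x : ℝ} (hx : 0 ≤ x)
    (hlarge : p.Above (M + (x : ℂ) • (1 : Matrix n n ℂ))) : p.Above M := by
  intro Y hY
  by_contra! hneg
  obtain ⟨N, Q, hNQ, -, hQ, hN, -, -⟩ := hp.exists_eval (hM.add hY.isHermitian) hA
    (PosSemidef.one (n := n) (R := ℂ))
  have hQ0 : Q.eval 0 ≤ 0 := by
    rw [← hQ]; simpa using hneg
  have hQx : ∀ t, x ≤ t → 0 < Q.eval t := fun t ht => by
    have h1 := hlarge (Y + ((t - x : ℝ) : ℂ) • (1 : Matrix n n ℂ))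
      (hY.add (posSemidef_ofReal_smul PosSemidef.one (by linarith)))
    rw [← hQ]
    convert h1 using 2
    push_cast
    module
  have hNltQ : ∀ t, 0 ≤ t → N.eval t < Q.eval t := fun t ht => by
    have h1 := h (Y + (t : ℂ) • (1 : Matrix n n ℂ)) (hY.add (posSemidef_ofReal_smul PosSemidef.one ht))
    rw [← add_assoc, val_subDir, hQ, hN] at h1
    linarith
  -- the last point of `[0, x]` at which `Q` is not positive
  obtain ⟨y, ⟨⟨hy0, hyx⟩, hQy⟩, hmax⟩ : ∃ y, IsGreatest (Set.Icc 0 x ∩ {t | Q.eval t ≤ 0}) y :=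
    (isCompact_Icc.inter_right (isClosed_le Q.continuous continuous_const)).exists_isGreatest
      ⟨0, ⟨le_rfl, hx⟩, hQ0⟩
  replace hQy : Q.eval y ≤ 0 := hQy
  have hpos : ∀ t, y < t → 0 < Q.eval t := fun t ht => by
    rcases le_total x t with h1 | h1
    · exact hQx t h1
    · by_contra! h2
      exact absurd (hmax ⟨⟨hy0.trans ht.le, h1⟩, h2⟩) (not_le.2 ht)
  have hyltx : y < x := lt_of_le_of_ne hyx fun h1 => absurd (hQx y h1.ge) (not_lt.2 hQy)
  have hNy : N.eval y < 0 := (hNltQ y hy0).trans_le hQy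
  obtain ⟨z, ⟨hyz, hzx⟩, hNz⟩ : ∃ z ∈ Set.Ioc y x, N.eval z < 0 := by
    have h1 : ∀ᶠ z in nhdsWithin y (Set.Ioi y), N.eval z < 0 :=
      (N.continuous.continuousAt.eventually_lt continuousAt_const hNy).filter_mono nhdsWithin_le_nhds
    obtain ⟨z, hz1, hz2⟩ := (h1.and (Ioc_mem_nhdsGT hyltx)).exists
    exact ⟨z, hz2, hz1⟩
  have hanti := hNQ.antitoneOn_div (a := z) (fun t ht => hpos t (hyz.trans_le ht))
    (Set.mem_Ici.2 le_rfl) (Set.mem_Ici.2 hzx) hzx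
  have h2 : N.eval z / Q.eval z < 0 := div_neg_of_neg_of_pos hNz (hpos z hyz)
  have h3 : 0 ≤ N.eval x / Q.eval x := by
    rw [← hQ, ← hN]
    have hxPos : ((x : ℂ) • (1 : Matrix n n ℂ)).PosSemidef := posSemidef_ofReal_smul PosSemidef.one hx
    have h4 := hlarge.add hY
    rw [add_right_comm] at h4
    exact hp.barrier_nonneg ((hM.add hY.isHermitian).add hxPos.isHermitian) hA h4
  simp only at hanti
  linarith

end IsStable
end MatPoly

/-! ### Products of the operators `1 - D_A` and the choice of directions -/

namespace MatPoly
open Matrix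
open scoped ComplexOrder

variable {n : Type*}

theorem foldr_subDir_subDir (l : List (Matrix n n ℂ)) (A : Matrix n n ℂ) (p : MatPoly n) :
    l.foldr subDir (subDir A p) = subDir A (l.foldr subDir p) := by
  induction l with
  | nil => rfl
  | cons B l ih => rw [List.foldr_cons, ih, subDir_comm, List.foldr_cons]

theorem dir_sum {κ : Type*} (S : Finset κ) (w : κ → ℂ) (B : κ → Matrix n n ℂ) (p : MatPoly n) :
    dir (∑ s ∈ S, w s • B s) p = ∑ s ∈ S, w s • dir (B s) p := by
  classical
  induction S using Finset.induction_on with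
  | empty =>
    have h := dir_smul 0 (0 : Matrix n n ℂ) p
    simpa using h
  | insert a S ha ih => rw [Finset.sum_insert ha, Finset.sum_insert ha, dir_add, dir_smul, ih]

theorem barrier_sum {κ : Type*} (S : Finset κ) (w : κ → ℝ) (B : κ → Matrix n n ℂ) (p : MatPoly n)
    (M : Matrix n n ℂ) :
    barrier (∑ s ∈ S, (w s : ℂ) • B s) p M = ∑ s ∈ S, w s * barrier (B s) p M := by
  have h : (dir (∑ s ∈ S, (w s : ℂ) • B s) p).val M = ∑ s ∈ S, w s * (dir (B s) p).val M := by
    rw [dir_sum]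
    simp [val, ev, Complex.re_sum, MvPolynomial.smul_eq_C_mul]
  simp only [barrier, h, Finset.sum_div, mul_div_assoc]

theorem IsStable.foldr_subDir [Fintype n] {p : MatPoly n} (hp : p.IsStable)
    {l : List (Matrix n n ℂ)} (hl : ∀ A ∈ l, A.PosSemidef) :
    (l.foldr MatPoly.subDir p).IsStable := by
  induction l with
  | nil => exact hp
  | cons A l ih =>
    exact (ih fun B hB => hl B (List.mem_cons_of_mem _ hB)).subDir (hl A List.mem_cons_self)

variable [Fintype n] [DecidableEq n]

open scoped MatrixOrder in
theorem exists_posSemidef_smul_one_sub {A : Matrix n n ℂ} (hA : A.IsHermitian) :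
    ∃ c : ℝ, 0 ≤ c ∧ ((c : ℂ) • (1 : Matrix n n ℂ) - A).PosSemidef := by
  refine ⟨‖A‖, norm_nonneg _, ?_⟩
  have h := IsSelfAdjoint.le_algebraMap_norm_self (a := A) hA
  rw [Matrix.le_iff] at h
  rw [Algebra.algebraMap_eq_smul_one] at h
  exact h

/-- Some nonnegative multiple of the identity lies above the roots of `p`. -/
def EventuallyAbove (p : MatPoly n) : Prop :=
  ∃ x : ℝ, 0 ≤ x ∧ p.Above ((x : ℂ) • (1 : Matrix n n ℂ))

namespace IsStable

variable {p : MatPoly n}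

/-- The barrier in direction `C` tends to `0` along the ray in direction `C`. -/
theorem eventuallyAbove_subDir (hp : p.IsStable) (h : p.EventuallyAbove) {C : Matrix n n ℂ}
    (hC : C.PosSemidef) : (MatPoly.subDir C p).EventuallyAbove := by
  obtain ⟨x, hx, hxp⟩ := h
  have hM : ((x : ℂ) • (1 : Matrix n n ℂ)).IsHermitian := isHermitian_ofReal_smul isHermitian_one x
  obtain ⟨-, Q, -, -, hQ, -, hQ', -⟩ := hp.exists_eval hM hC hC
  obtain ⟨t, htlt, ht⟩ := ((Q.tendsto_derivative_div.eventually_lt_const zero_lt_one).and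
    (Filter.eventually_ge_atTop 0)).exists
  obtain ⟨c, hc, hcC⟩ := exists_posSemidef_smul_one_sub hC.isHermitian
  have htC := posSemidef_ofReal_smul hC ht
  rw [← hQ, ← hQ'] at htlt
  have h1 := (hp.above_subDir_of_barrier_lt (hM.add htC.isHermitian) hC (hxp.add htC) htlt).add
    (posSemidef_ofReal_smul hcC ht)
  refine ⟨x + t * c, by positivity, ?_⟩
  convert h1 using 1
  push_cast
  module

theorem eventuallyAbove_foldr_subDir (hp : p.IsStable) (h : p.EventuallyAbove)
    {l : List (Matrix n n ℂ)} (hl : ∀ A ∈ l, A.PosSemidef) :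
    (l.foldr MatPoly.subDir p).EventuallyAbove := by
  induction l with
  | nil => exact h
  | cons A l ih =>
    have hl' : ∀ B ∈ l, B.PosSemidef := fun B hB => hl B (List.mem_cons_of_mem _ hB)
    exact (hp.foldr_subDir hl').eventuallyAbove_subDir (ih hl') (hl A List.mem_cons_self)

/-- The barrier argument: one shift for each of the matrices in the list. -/
theorem above_foldr_subDir (hp : p.IsStable) {M : Matrix n n ℂ} (hM : M.IsHermitian) (h : p.Above M)
    {δ : ℝ} (hδ : 0 < δ) {l : List (Matrix n n ℂ)}
    (hl : ∀ A ∈ l, A.PosSemidef ∧ barrier A p M ≤ 1 - 1 / δ) :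
    (l.foldr MatPoly.subDir p).Above (M + (δ : ℂ) • l.sum) ∧
      ∀ B : Matrix n n ℂ, B.PosSemidef →
        barrier B (l.foldr MatPoly.subDir p) (M + (δ : ℂ) • l.sum) ≤ barrier B p M := by
  induction l with
  | nil => simpa using h
  | cons A l ih =>
    have hl' : ∀ B ∈ l, B.PosSemidef ∧ barrier B p M ≤ 1 - 1 / δ := fun B hB =>
      hl B (List.mem_cons_of_mem _ hB)
    obtain ⟨hA, hbA⟩ := hl A List.mem_cons_self
    obtain ⟨ih1, ih2⟩ := ih hl'
    have hsum : l.sum.IsHermitian := by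
      clear ih ih1 ih2 hl
      induction l with
      | nil => exact isHermitian_zero
      | cons B l ih =>
        rw [List.sum_cons]
        exact (hl' B List.mem_cons_self).1.isHermitian.add
          (ih fun D hD => hl' D (List.mem_cons_of_mem _ hD))
    have h1 := (hp.foldr_subDir fun B hB => (hl' B hB).1).above_subDir
      (hM.add (isHermitian_ofReal_smul hsum δ)) hA ih1 hδ ((ih2 A hA).trans hbA)
    rw [List.foldr_cons, List.sum_cons, smul_add, ← add_assoc, add_right_comm]
    exact ⟨h1.1, fun B hB => (h1.2 B hB).trans (ih2 B hB)⟩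

/-- The choice for one factor: the barrier is linear in its direction, so for some `s` the barrier
in direction `B s` does not exceed the average. -/
theorem exists_above_subDir (hp : p.IsStable) (hlarge : p.EventuallyAbove) {M : Matrix n n ℂ}
    (hM : M.PosSemidef) {κ : Type*} {S : Finset κ} {w : κ → ℝ} {B : κ → Matrix n n ℂ}
    (hw : ∀ s ∈ S, 0 ≤ w s) (hw1 : ∑ s ∈ S, w s = 1) (hB : ∀ s ∈ S, (B s).PosSemidef)
    (h : (MatPoly.subDir (∑ s ∈ S, (w s : ℂ) • B s) p).Above M) :
    ∃ s ∈ S, 0 < w s ∧ (MatPoly.subDir (B s) p).Above M := by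
  have hA : (∑ s ∈ S, (w s : ℂ) • B s).PosSemidef :=
    posSemidef_sum S fun s hs => posSemidef_ofReal_smul (hB s hs) (hw s hs)
  obtain ⟨x, hx, hxp⟩ := hlarge
  have hp' : p.Above M := by
    refine hp.above_of_above_subDir hM.isHermitian hA h hx ?_
    rw [add_comm]
    exact hxp.add hM
  have h1 := hp'.val_subDir_pos_iff.1 h.val_pos
  rw [barrier_sum, ← hw1] at h1
  obtain ⟨s, hs, hlt⟩ := Finset.exists_lt_of_sum_lt h1
  have hws : 0 < w s := by
    rcases (hw s hs).lt_or_eq with h2 | h2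
    · exact h2
    · rw [← h2, zero_mul] at hlt
      exact absurd hlt (lt_irrefl _)
  refine ⟨s, hs, hws, hp.above_subDir_of_barrier_lt hM.isHermitian (hB s hs) hp' ?_⟩
  nlinarith

/-- The choice for all factors, one after the other; the factor in question is moved to the
outermost place by commuting the operators. -/
theorem exists_above_foldr_subDir {ι κ : Type*} [DecidableEq ι] [Nonempty κ] {M : Matrix n n ℂ}
    (hM : M.PosSemidef) {S : ι → Finset κ} {w : ι → κ → ℝ} {B : κ → Matrix n n ℂ}
    (hw : ∀ i, ∀ s ∈ S i, 0 ≤ w i s) (hw1 : ∀ i, ∑ s ∈ S i, w i s = 1)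
    (hB : ∀ s, (B s).PosSemidef) {l : List ι} (hl : l.Nodup) (hp : p.IsStable)
    (hlarge : p.EventuallyAbove)
    (h : ((l.map fun i => ∑ s ∈ S i, (w i s : ℂ) • B s).foldr MatPoly.subDir p).Above M) :
    ∃ f : ι → κ, (∀ i ∈ l, f i ∈ S i ∧ 0 < w i (f i)) ∧
      ((l.map fun i => B (f i)).foldr MatPoly.subDir p).Above M := by
  have hA : ∀ i, (∑ s ∈ S i, (w i s : ℂ) • B s).PosSemidef := fun i =>
    posSemidef_sum _ fun s hs => posSemidef_ofReal_smul (hB s) (hw i s hs)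
  induction l generalizing p with
  | nil => exact ⟨fun _ => Classical.arbitrary κ, by simp, h⟩
  | cons i l ih =>
    have hl' : ∀ A ∈ l.map fun i => ∑ s ∈ S i, (w i s : ℂ) • B s, A.PosSemidef := by
      intro A hAl
      obtain ⟨j, -, rfl⟩ := List.mem_map.1 hAl
      exact hA j
    obtain ⟨s, hs, hws, hs'⟩ := (hp.foldr_subDir hl').exists_above_subDir
      (hp.eventuallyAbove_foldr_subDir hlarge hl') hM (hw i) (hw1 i) (fun s _ => hB s) h
    rw [← foldr_subDir_subDir] at hs'
    obtain ⟨hi, hnd⟩ := List.nodup_cons.1 hl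
    obtain ⟨f, hf, hf'⟩ := ih hnd (hp.subDir (hB s)) (hp.eventuallyAbove_subDir hlarge (hB s)) hs'
    have hne : ∀ j ∈ l, Function.update f i s j = f j := fun j hj =>
      Function.update_of_ne (by rintro rfl; exact hi hj) _ _
    refine ⟨Function.update f i s, ?_, ?_⟩
    · intro j hj
      rcases List.mem_cons.1 hj with rfl | hj
      · rw [Function.update_self]; exact ⟨hs, hws⟩
      · rw [hne j hj]; exact hf j hj
    · rw [List.map_cons, List.foldr_cons, Function.update_self, ← foldr_subDir_subDir,
        List.map_congr_left fun j hj => by rw [hne j hj]]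
      exact hf'

end IsStable
end MatPoly

/-! ### The determinant as a stable polynomial -/

namespace Matrix

/-- The determinant is affine along rank-one directions. -/
theorem det_add_smul_vecMulVec {n R : Type*} [Fintype n] [DecidableEq n] [CommRing R]
    (M : Matrix n n R) (u v : n → R) :
    ∃ c : R, ∀ z : R, (M + z • vecMulVec u v).det = M.det + z * c := by
  classical
  -- border the matrix by a row and a column; the bordering column is affine in `z`
  set F : Matrix (n ⊕ Unit) (n ⊕ Unit) R := fromBlocks M 0 (replicateRow Unit v) 1 with hF
  refine ⟨(F.updateCol (Sum.inr ()) (Sum.elim (-u) 0)).det, fun z => ?_⟩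
  have h1 : M + z • vecMulVec u v
      = M - replicateCol Unit (z • -u) * replicateRow Unit v := by
    rw [← vecMulVec_eq, smul_vecMulVec, neg_vecMulVec]
    simp
  have h2 : fromBlocks M (replicateCol Unit (z • -u)) (replicateRow Unit v) 1
      = F.updateCol (Sum.inr ()) (z • Sum.elim (-u) 0 + Sum.elim (0 : n → R) (1 : Unit → R)) := by
    ext (i | i) (j | j) <;> simp [F]
  have h3 : F.updateCol (Sum.inr ()) (Sum.elim (0 : n → R) (1 : Unit → R)) = F := by
    ext (i | i) (j | j) <;> simp [F]
  rw [h1, ← det_fromBlocks_one₂₂, h2, det_updateCol_add, det_updateCol_smul, h3, hF,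
    det_fromBlocks_one₂₂]
  simp [add_comm]

end Matrix

namespace MatPoly
open Matrix
open scoped ComplexOrder

variable {n : Type*} [Fintype n] [DecidableEq n]

variable (n) in
/-- The determinant as a polynomial in the entries. -/
noncomputable def detPoly : MatPoly n := (mvPolynomialX n n ℂ).det

theorem ev_detPoly (M : Matrix n n ℂ) : (detPoly n).ev M = M.det := by
  rw [ev, detPoly, eval_det_mvPolynomialX]
  rfl

/-- On translates of the determinant, `1 - D_A` with `A` of rank one is translation by `A`. -/
theorem ev_subDir_vecMulVec {p : MatPoly n} {B : Matrix n n ℂ} (hp : ∀ M, p.ev M = (M - B).det)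
    (u v : n → ℂ) (M : Matrix n n ℂ) :
    (subDir (vecMulVec u v) p).ev M = (M - (vecMulVec u v + B)).det := by
  obtain ⟨c, hc⟩ := det_add_smul_vecMulVec (M - B) u v
  have hline : p.line M (vecMulVec u v) =
      Polynomial.C (M - B).det + Polynomial.C c * Polynomial.X := by
    apply Polynomial.funext
    intro z
    rw [eval_line, hp, add_sub_right_comm, hc]
    simp only [Polynomial.eval_add, Polynomial.eval_mul, Polynomial.eval_C, Polynomial.eval_X]
    ring
  have hder := congrArg (fun q => (Polynomial.derivative q).eval 0) hline
  simp only [derivative_line, eval_line, zero_smul, add_zero] at hder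
  rw [ev_subDir, hp, hder]
  have h1 := hc (-1)
  rw [show M - (vecMulVec u v + B) = M - B + (-1 : ℂ) • vecMulVec u v by module, h1]
  simp
  ring

theorem ev_foldr_subDir_detPoly {ι : Type*} (l : List ι) (u v : ι → n → ℂ) (M : Matrix n n ℂ) :
    ((l.map fun i => vecMulVec (u i) (v i)).foldr subDir (detPoly n)).ev M =
      (M - (l.map fun i => vecMulVec (u i) (v i)).sum).det := by
  induction l generalizing M with
  | nil => simp [ev_detPoly]
  | cons i l ih =>
    simp only [List.map_cons, List.foldr_cons, List.sum_cons]
    exact ev_subDir_vecMulVec ih _ _ _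

theorem isStable_detPoly : (detPoly n).IsStable where
  isReal X hX := by
    rw [ev_detPoly, ← Complex.conj_eq_iff_im, ← Complex.star_def, ← det_conjTranspose, hX.eq]
  ev_ne_zero X Y hX hY := by
    rw [ev_detPoly]
    intro h
    obtain ⟨v, hv, hv0⟩ := exists_mulVec_eq_zero_iff.2 h
    have h1 := hX.im_star_dotProduct_mulVec_self v
    have h2 := hY.dotProduct_mulVec_pos hv
    have h3 := congrArg (fun x => (star v ⬝ᵥ x).im) hv0
    simp only [add_mulVec, smul_mulVec, dotProduct_add, dotProduct_smul, dotProduct_zero] at h3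
    rw [Complex.lt_def] at h2
    simp at h1 h2 h3
    linarith [h2.1]

theorem above_detPoly {t : ℝ} (ht : 0 < t) :
    (detPoly n).Above ((t : ℂ) • (1 : Matrix n n ℂ)) := by
  intro Y hY
  have h : ((t : ℂ) • (1 : Matrix n n ℂ) + Y).PosDef :=
    (PosDef.one.smul (by exact_mod_cast ht)).add_posSemidef hY
  rw [val, ev_detPoly]
  exact (Complex.lt_def.1 h.det_pos).1

theorem barrier_detPoly {t : ℝ} (ht : 0 < t) (A : Matrix n n ℂ) :
    barrier A (detPoly n) ((t : ℂ) • (1 : Matrix n n ℂ)) = A.trace.re / t := by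
  have htc : (t : ℂ) ≠ 0 := by exact_mod_cast ht.ne'
  have hline : (detPoly n).line ((t : ℂ) • (1 : Matrix n n ℂ)) ((t : ℂ) • A) =
      Polynomial.C ((t : ℂ) ^ Fintype.card n) *
        (1 + (Polynomial.X : Polynomial ℂ) • A.map Polynomial.C).det := by
    apply Polynomial.funext
    intro z
    have h1 : (1 + (Polynomial.X : Polynomial ℂ) • A.map Polynomial.C).det.eval z =
        (1 + z • A).det := by
      rw [← Polynomial.coe_evalRingHom, RingHom.map_det]
      congr 1
      ext i j
      simp only [RingHom.mapMatrix_apply, map_apply, Matrix.add_apply, Matrix.smul_apply, Matrix.one_apply,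
        smul_eq_mul, Polynomial.coe_evalRingHom, Polynomial.eval_add, Polynomial.eval_mul,
        Polynomial.eval_X, Polynomial.eval_C]
      split_ifs <;> simp
    rw [eval_line, ev_detPoly, Polynomial.eval_mul, Polynomial.eval_C, h1, ← det_smul]
    congr 1
    module
  have hder := congrArg (fun q => (Polynomial.derivative q).eval 0) hline
  simp only [derivative_line, eval_line, zero_smul, add_zero, Polynomial.derivative_C_mul,
    Polynomial.eval_mul, Polynomial.eval_C, derivative_det_one_add_X_smul, dir_smul] at hder
  have h2 : (dir A (detPoly n)).ev ((t : ℂ) • (1 : Matrix n n ℂ)) =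
      ((t ^ Fintype.card n : ℝ) : ℂ) * A.trace / (t : ℂ) := by
    rw [eq_div_iff htc, mul_comm]
    push_cast
    rw [← hder]
    simp [ev, MvPolynomial.smul_eq_C_mul]
  rw [barrier, val, val, h2, ev_detPoly, det_smul, det_one, mul_one, Complex.div_ofReal_re,
    Complex.re_ofReal_mul, ← Complex.ofReal_pow, Complex.ofReal_re]
  have : t ^ Fintype.card n ≠ 0 := pow_ne_zero _ ht.ne'
  field_simp

end MatPoly

open scoped ComplexOrder MatrixOrder in
theorem Matrix.norm_le_of_det_ne_zero {n : Type*} [Fintype n] [DecidableEq n] {S : Matrix n n ℂ}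
    (hS : S.PosSemidef) {lam : ℝ} (hlam : 0 ≤ lam)
    (h : ∀ x : ℝ, lam ≤ x → ((x : ℂ) • (1 : Matrix n n ℂ) - S).det ≠ 0) : ‖S‖ ≤ lam := by
  cases subsingleton_or_nontrivial (Matrix n n ℂ)
  · rw [Subsingleton.elim S 0, norm_zero]; exact hlam
  by_contra! hlt
  have h1 : ‖S‖ ∈ spectrum ℝ S := CStarAlgebra.norm_mem_spectrum_of_nonneg hS.nonneg
  rw [spectrum.mem_iff, Matrix.isUnit_iff_isUnit_det] at h1
  apply h1
  rw [isUnit_iff_ne_zero]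
  have h2 := h ‖S‖ hlt.le
  rw [Algebra.algebraMap_eq_smul_one]
  exact h2

/-! ### Random vectors with finite support -/

theorem outerProduct_eq_vecMulVec {d : ℕ} (v : EuclideanSpace ℂ (Fin d)) :
    outerProduct v = Matrix.vecMulVec v.ofLp (star v.ofLp) := rfl

open scoped ComplexOrder in
theorem posSemidef_outerProduct {d : ℕ} (v : EuclideanSpace ℂ (Fin d)) :
    (outerProduct v).PosSemidef :=
  Matrix.posSemidef_vecMulVec_self_star _

theorem trace_outerProduct {d : ℕ} (v : EuclideanSpace ℂ (Fin d)) :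
    (outerProduct v).trace = ((‖v‖ ^ 2 : ℝ) : ℂ) := by
  rw [EuclideanSpace.norm_sq_eq]
  simp [Matrix.trace, outerProduct, Complex.mul_conj, Complex.normSq_eq_norm_sq]

open MatPoly in
open scoped ComplexOrder in
/-- The theorem for finite probability distributions `w i` on `S i`, as the existence of a choice of
values of positive probability. -/
theorem exists_norm_sum_outerProduct_le {d m : ℕ} {ε : ℝ} (hε : 0 < ε)
    {S : Fin m → Finset (EuclideanSpace ℂ (Fin d))} {w : Fin m → EuclideanSpace ℂ (Fin d) → ℝ}
    (hw : ∀ i, ∀ s ∈ S i, 0 ≤ w i s) (hw1 : ∀ i, ∑ s ∈ S i, w i s = 1)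
    (hsum : ∑ i, ∑ s ∈ S i, (w i s : ℂ) • outerProduct s = (1 : Matrix (Fin d) (Fin d) ℂ))
    (hbound : ∀ i, ∑ s ∈ S i, w i s * ‖s‖ ^ 2 ≤ ε) :
    ∃ f : Fin m → EuclideanSpace ℂ (Fin d), (∀ i, f i ∈ S i ∧ 0 < w i (f i)) ∧
      ‖∑ i, outerProduct (f i)‖ ≤ (1 + Real.sqrt ε) ^ 2 := by
  set r := Real.sqrt ε with hr
  have hr0 : 0 < r := Real.sqrt_pos.2 hε
  have hrr : r * r = ε := Real.mul_self_sqrt hε.le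
  set A : Fin m → Matrix (Fin d) (Fin d) ℂ := fun i => ∑ s ∈ S i, (w i s : ℂ) • outerProduct s
  have hA : ∀ i, (A i).PosSemidef := fun i => Matrix.posSemidef_sum _ fun s hs =>
    posSemidef_ofReal_smul (posSemidef_outerProduct s) (hw i s hs)
  have htr : ∀ i, (A i).trace.re ≤ ε := fun i => by
    refine le_trans (le_of_eq ?_) (hbound i)
    simp only [A, Matrix.trace_sum, Matrix.trace_smul, trace_outerProduct, Complex.re_sum, smul_eq_mul,
      Complex.re_ofReal_mul, Complex.ofReal_re]
  set t := r + ε with ht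
  have ht0 : 0 < t := by positivity
  have hlist : ∀ B ∈ (List.finRange m).map A, B.PosSemidef ∧
      barrier B (detPoly (Fin d)) ((t : ℂ) • (1 : Matrix (Fin d) (Fin d) ℂ)) ≤ 1 - 1 / (1 + r) := by
    intro B hB
    obtain ⟨i, -, rfl⟩ := List.mem_map.1 hB
    refine ⟨hA i, ?_⟩
    rw [barrier_detPoly ht0]
    have h1 : 1 - 1 / (1 + r) = ε / t := by
      rw [ht, ← hrr]
      field_simp
      ring
    rw [h1]
    gcongr
    exact htr i
  have hlsum : ((List.finRange m).map A).sum = 1 := by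
    rw [← hsum, ← List.ofFn_eq_map, List.sum_ofFn]
  -- shifting `t • 1` by `(1 + r) • ∑ A i` leads to `(1 + r) ^ 2 • 1`, above the roots of
  -- the product
  have habove := (isStable_detPoly.above_foldr_subDir
    (isHermitian_ofReal_smul Matrix.isHermitian_one t) (above_detPoly ht0)
    (by positivity : 0 < 1 + r) hlist).1
  have hM : (t : ℂ) • (1 : Matrix (Fin d) (Fin d) ℂ) + ((1 + r : ℝ) : ℂ) • (1 : Matrix (Fin d) (Fin d) ℂ)
      = (((1 + r) ^ 2 : ℝ) : ℂ) • (1 : Matrix (Fin d) (Fin d) ℂ) := by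
    rw [← add_smul, ← Complex.ofReal_add, ht, ← hrr]
    congr 2
    ring
  rw [hlsum, hM] at habove
  obtain ⟨f, hf, hfabove⟩ := isStable_detPoly.exists_above_foldr_subDir (B := outerProduct)
    (posSemidef_ofReal_smul Matrix.PosSemidef.one (by positivity)) hw hw1 posSemidef_outerProduct
    (List.nodup_finRange m) ⟨1, zero_le_one, above_detPoly one_pos⟩ habove
  refine ⟨f, fun i => hf i (List.mem_finRange i), ?_⟩
  refine Matrix.norm_le_of_det_ne_zero (Matrix.posSemidef_sum _ fun i _ => posSemidef_outerProduct _)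
    (by positivity) fun x hx => ?_
  have h1 := hfabove ((((x - (1 + r) ^ 2 : ℝ)) : ℂ) • (1 : Matrix (Fin d) (Fin d) ℂ))
    (posSemidef_ofReal_smul Matrix.PosSemidef.one (by linarith))
  simp only [outerProduct_eq_vecMulVec] at h1 ⊢
  rw [← add_smul, ← Complex.ofReal_add, add_sub_cancel, val, ev_foldr_subDir_detPoly,
    ← List.ofFn_eq_map, List.sum_ofFn] at h1
  intro h0
  rw [h0] at h1
  exact lt_irrefl _ h1

theorem integral_comp_eq_sum {Ω E F : Type*} [MeasurableSpace Ω] [MeasurableSpace E]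
    [MeasurableSingletonClass E] [NormedAddCommGroup F] [NormedSpace ℝ F] [CompleteSpace F]
    {μ : Measure Ω} [IsFiniteMeasure μ] {X : Ω → E} (hX : Measurable X) {S : Finset E}
    (hS : ∀ᵐ ω ∂μ, X ω ∈ S) (g : E → F) :
    ∫ ω, g (X ω) ∂μ = ∑ s ∈ S, μ.real (X ⁻¹' {s}) • g s := by
  classical
  have hmeas : ∀ s, MeasurableSet (X ⁻¹' {s}) := fun s => hX (measurableSet_singleton s)
  have h1 : (fun ω => g (X ω)) =ᵐ[μ]
      fun ω => ∑ s ∈ S, (X ⁻¹' {s}).indicator (fun _ => g s) ω := by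
    filter_upwards [hS] with ω hω
    have hne : ∀ s ∈ S, s ≠ X ω → (X ⁻¹' {s}).indicator (fun _ => g s) ω = 0 := fun s _ hs =>
      Set.indicator_of_notMem (s := X ⁻¹' {s}) (a := ω)
        (fun h => hs (Set.mem_singleton_iff.1 h).symm) _
    rw [Finset.sum_eq_single_of_mem (X ω) hω hne,
      Set.indicator_of_mem (s := X ⁻¹' {X ω}) (a := ω) rfl]
  rw [integral_congr_ae h1, integral_finsetSum]
  · exact Finset.sum_congr rfl fun s _ => integral_indicator_const _ (hmeas s)
  · exact fun s _ => (integrable_const _).indicator (hmeas s)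

theorem mainTheorem1 {Ω : Type*} [MeasurableSpace Ω] (μ : Measure Ω) [IsProbabilityMeasure μ]
    (d m : ℕ) (ε : ℝ) (hε : 0 < ε)
    (v : Fin m → Ω → EuclideanSpace ℂ (Fin d))
    (hmeas : ∀ i, Measurable (v i))
    (hindep : iIndepFun v μ)
    (hfin : ∀ i, ∃ S : Set (EuclideanSpace ℂ (Fin d)), S.Finite ∧ ∀ᵐ ω ∂μ, v i ω ∈ S)
    (hsum : ∑ i, ∫ ω, outerProduct (v i ω) ∂μ = (1 : Matrix (Fin d) (Fin d) ℂ))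
    (hbound : ∀ i, ∫ ω, ‖v i ω‖ ^ 2 ∂μ ≤ ε) :
    0 < μ {ω | ‖∑ i, outerProduct (v i ω)‖ ≤ (1 + Real.sqrt ε) ^ 2} := by
  choose S₀ hS₀ hae₀ using hfin
  set S : Fin m → Finset (EuclideanSpace ℂ (Fin d)) := fun i => (hS₀ i).toFinset with hS
  have hae : ∀ i, ∀ᵐ ω ∂μ, v i ω ∈ S i := fun i => by
    filter_upwards [hae₀ i] with ω hω
    exact (hS₀ i).mem_toFinset.2 hω
  obtain ⟨f, hf, hnorm⟩ := exists_norm_sum_outerProduct_le (S := S)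
    (w := fun i s => μ.real (v i ⁻¹' {s})) hε (fun i s _ => measureReal_nonneg)
    (fun i => by
      have h := integral_comp_eq_sum (hmeas i) (hae i) fun _ => (1 : ℝ)
      simpa using h.symm)
    (by
      rw [← hsum]
      refine Finset.sum_congr rfl fun i _ => ?_
      rw [integral_comp_eq_sum (hmeas i) (hae i) outerProduct]
      exact Finset.sum_congr rfl fun s _ => Complex.coe_smul _ _)
    (fun i => by
      have h := hbound i
      rw [integral_comp_eq_sum (hmeas i) (hae i) fun s => ‖s‖ ^ 2] at h
      exact h)
  -- the chosen values occur together with positive probability, by independence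
  have hpos : 0 < μ (⋂ i, v i ⁻¹' {f i}) := by
    rw [hindep.meas_iInter fun i => ⟨{f i}, measurableSet_singleton _, rfl⟩]
    refine pos_iff_ne_zero.2 (Finset.prod_ne_zero_iff.2 fun i _ => ?_)
    have h := (hf i).2
    rw [measureReal_def] at h
    exact (ENNReal.toReal_pos_iff.1 h).1.ne'
  refine hpos.trans_le (measure_mono fun ω hω => ?_)
  have hω' : ∀ i, v i ω = f i := fun i => Set.mem_iInter.1 hω i
  change ‖∑ i, outerProduct (v i ω)‖ ≤ (1 + Real.sqrt ε) ^ 2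
  simp only [hω']
  exact hnorm
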